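/- Let $\Sigma$ be a finite alphabet, let $\mathsf{a}\in\Sigma$, and let $\mathsf{Vars}$ be an infinite set of variables. A \emph{span} of a string $\mathbf{s}=\sigma_1\cdots\sigma_n\in\Sigma^*$ is a pair $[i,j\rangle$ with $1\le i\le j\le n+1$; it identifies the substring $\mathbf{s}_{[i,j\rangle}=\sigma_i\cdots\sigma_{j-1}$. For a finite $V\subset\mathsf{Vars}$, a $(V,\mathbf{s})$-\emph{record} is a function from $V$ to the spans of $\mathbf{s}$. A \emph{spanner} $P$ with variable set $V$ maps every $\mathbf{s}\in\Sigma^*$ to a set $P(\mathbf{s})$ of $(V,\mathbf{s})$-records. It is \emph{Boolean} if $V=\emptyset$; it then \emph{recognizes} the language of all $\mathbf{s}$ for which $P(\mathbf{s})$ is the singleton $\mathbf{true}$ consisting of the empty record. A \emph{regex formula} is an expression $\gamma::=\emptyset\mid\epsilon\mid\sigma\mid\gamma\vee\gamma\mid\gamma\cdot\gamma\mid\gamma^*\mid x\{\gamma\}$ (with $\sigma\in\Sigma$ and $x\in\mathsf{Vars}$) that is functional: every match (parse) of $\gamma$ on an entire string of $\Sigma^*$ assigns precisely one span to each variable occurring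 in $\gamma$, where a variable $x$ is assigned the span of the part matched by an occurrence of $x\{\cdot\}$. It represents the spanner whose variables are those that occur in $\gamma$ and whose records on $\mathbf{s}$ are the assignments given by the matches of $\gamma$ on all of $\mathbf{s}$. A \emph{generalized core spanner} is a spanner obtained from regex formulas by finitely many applications of union $P_1\cup P_2$ and difference $P_1\setminus P_2$ (of spanners with the same variable set), projection $\pi_Y P$ (to a subset $Y$ of the variables), natural join $P_1\bowtie P_2$, and string-equality selection $\zeta^=_{x,y}P$ (which keeps the records $r$ with $\mathbf{s}_{r(x)}=\mathbf{s}_{r(y)}$). \textbf{Theorem.} A language $L\subseteq\{\mathsf{a}\}^*$ is recognized by a Boolean generalized core spanner if and only if the set $\mathbb{N}(L)=\{m\in\mathbb{N}\mid \mathsf{a}^m\in L\}$ is definable in Presburger arithmetic, that is, if and only if there is a first-order formula $\varphi(x)$ over $(\mathbb{N};0,1,+)$ with $\mathbb{N}(L)=\{m\in\mathbb{N}\mid\varphi(m)\}$. -/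

import Mathlib

universe u v

namespace DocSpanner

/-- The set of spans of the string `s`: the pairs `[i, j⟩` with `1 ≤ i ≤ j ≤ |s| + 1`. -/
def Span {A : Type u} (s : List A) : Type :=
  {p : ℕ × ℕ // 1 ≤ p.1 ∧ p.1 ≤ p.2 ∧ p.2 ≤ s.length + 1}

/-- The substring `σ_i ⋯ σ_{j-1}` of `s = σ_1 ⋯ σ_n` identified by the span `[i, j⟩`. -/
def Span.substring {A : Type u} {s : List A} (p : Span s) : List A :=
  (s.drop (p.1.1 - 1)).take (p.1.2 - p.1.1)

/-- A `(V, s)`-record: a function that maps the variables of `V` to spans of `s`. -/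
def Record {A : Type u} {Var : Type v} (V : Finset Var) (s : List A) : Type v :=
  {x : Var // x ∈ V} → Span s

/-- The restriction of a record to a subset of its variables. -/
def Record.restrict {A : Type u} {Var : Type v} {V Y : Finset Var} {s : List A}
    (r : Record V s) (h : Y ⊆ V) : Record Y s :=
  fun y => r ⟨y.1, h y.2⟩

/-- The empty record, the only record over no variables. -/
def Record.empty {A : Type u} {Var : Type v} (s : List A) : Record (∅ : Finset Var) s :=
  fun x => absurd x.2 (Finset.notMem_empty x.1)

/-- A document spanner with variable set `V` maps every string `s` to a `(V, s)`-relation. -/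
def Spanner (A : Type u) {Var : Type v} (V : Finset Var) : Type (max u v) :=
  (s : List A) → Set (Record V s)

namespace Spanner

variable {A : Type u} {Var : Type v}

/-- The union of two spanners over the same variables. -/
def union {V : Finset Var} (P Q : Spanner A V) : Spanner A V :=
  fun s => P s ∪ Q s

/-- The difference of two spanners over the same variables. -/
def diff {V : Finset Var} (P Q : Spanner A V) : Spanner A V :=
  fun s => P s \ Q s

/-- The projection of a spanner to a subset `Y` of its variables. -/
def proj {V Y : Finset Var} (P : Spanner A V) (h : Y ⊆ V) : Spanner A Y :=
  fun s => {r | ∃ r₀ ∈ P s, r₀.restrict h = r}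

/-- The natural join of two spanners. -/
def join [DecidableEq Var] {V W : Finset Var} (P : Spanner A V) (Q : Spanner A W) :
    Spanner A (V ∪ W) :=
  fun s => {r | r.restrict Finset.subset_union_left ∈ P s ∧
    r.restrict Finset.subset_union_right ∈ Q s}

/-- The string-equality selection: the records whose spans for `x` and `y` have equal substrings. -/
def strEq {V : Finset Var} (P : Spanner A V) (x y : {x : Var // x ∈ V}) : Spanner A V :=
  fun s => {r | r ∈ P s ∧ (r x).substring = (r y).substring}

/-- The language recognized by a Boolean spanner `P`: the strings `s` such that `P s` is
`true`, that is, the singleton that consists of the empty record. -/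
def recognized (P : Spanner A (∅ : Finset Var)) : Language A :=
  {s : List A | P s = {Record.empty s}}

end Spanner

/-- Regular expressions over the alphabet `A` with capture variables from `Var`;
`capture x γ` is written `x{γ}`. -/
inductive VarRegex (A : Type u) (Var : Type v) : Type (max u v)
  | empty : VarRegex A Var
  | epsilon : VarRegex A Var
  | letter (σ : A) : VarRegex A Var
  | alt (γ δ : VarRegex A Var) : VarRegex A Var
  | concat (γ δ : VarRegex A Var) : VarRegex A Var
  | star (γ : VarRegex A Var) : VarRegex A Var
  | capture (x : Var) (γ : VarRegex A Var) : VarRegex A Var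

namespace VarRegex

variable {A : Type u} {Var : Type v}

/-- The variables that occur in an expression. -/
def vars [DecidableEq Var] : VarRegex A Var → Finset Var
  | empty => ∅
  | epsilon => ∅
  | letter _ => ∅
  | alt γ δ => γ.vars ∪ δ.vars
  | concat γ δ => γ.vars ∪ δ.vars
  | star γ => γ.vars
  | capture x γ => insert x γ.vars

/-- `Parse γ k w c`: there is a parse (a match) of the string `w` by `γ`, where `w` is read as the
part of a string that starts at position `k`, and `c` lists all captures made in this parse, with
repetitions: an entry `(x, (i, j))` says that `x` was assigned the span `[i, j⟩`. -/
inductive Parse : VarRegex A Var → ℕ → List A → List (Var × (ℕ × ℕ)) → Prop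
  | epsilon (k : ℕ) : Parse epsilon k [] []
  | letter (σ : A) (k : ℕ) : Parse (letter σ) k [σ] []
  | alt_left {γ δ : VarRegex A Var} {k : ℕ} {w : List A} {c : List (Var × (ℕ × ℕ))} :
      Parse γ k w c → Parse (alt γ δ) k w c
  | alt_right {γ δ : VarRegex A Var} {k : ℕ} {w : List A} {c : List (Var × (ℕ × ℕ))} :
      Parse δ k w c → Parse (alt γ δ) k w c
  | concat {γ δ : VarRegex A Var} {k : ℕ} {w₁ w₂ : List A} {c₁ c₂ : List (Var × (ℕ × ℕ))} :
      Parse γ k w₁ c₁ → Parse δ (k + w₁.length) w₂ c₂ →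
        Parse (concat γ δ) k (w₁ ++ w₂) (c₁ ++ c₂)
  | star_nil {γ : VarRegex A Var} (k : ℕ) : Parse (star γ) k [] []
  | star_cons {γ : VarRegex A Var} {k : ℕ} {w₁ w₂ : List A} {c₁ c₂ : List (Var × (ℕ × ℕ))} :
      Parse γ k w₁ c₁ → Parse (star γ) (k + w₁.length) w₂ c₂ →
        Parse (star γ) k (w₁ ++ w₂) (c₁ ++ c₂)
  | capture {x : Var} {γ : VarRegex A Var} {k : ℕ} {w : List A} {c : List (Var × (ℕ × ℕ))} :
      Parse γ k w c → Parse (capture x γ) k w ((x, (k, k + w.length)) :: c)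

/-- An expression is functional if every parse of every string assigns precisely one span to each
variable of the expression. The functional expressions are the regex formulas. -/
def Functional [DecidableEq Var] (γ : VarRegex A Var) : Prop :=
  ∀ (s : List A) (c : List (Var × (ℕ × ℕ))), Parse γ 1 s c →
    ∀ x ∈ γ.vars, (c.map Prod.fst).count x = 1

/-- The spanner of a regex formula: every parse of the whole input string yields the record of
the spans that are assigned to the variables. -/
def spanner [DecidableEq Var] (γ : VarRegex A Var) : Spanner A γ.vars :=
  fun s => {r | ∃ c : List (Var × (ℕ × ℕ)), Parse γ 1 s c ∧
    ∀ x : {x : Var // x ∈ γ.vars}, (x.1, (r x).1) ∈ c}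

end VarRegex

/-- The expressions of the closure of the regex formulas under union, projection, natural join,
string-equality selection and difference, indexed by their variable sets. -/
inductive GenCoreExpr (A : Type u) (Var : Type v) [DecidableEq Var] :
    Finset Var → Type (max u v)
  | rgx (γ : VarRegex A Var) (hγ : γ.Functional) : GenCoreExpr A Var γ.vars
  | union {V : Finset Var} (p q : GenCoreExpr A Var V) : GenCoreExpr A Var V
  | proj {V Y : Finset Var} (p : GenCoreExpr A Var V) (h : Y ⊆ V) : GenCoreExpr A Var Y
  | join {V W : Finset Var} (p : GenCoreExpr A Var V) (q : GenCoreExpr A Var W) :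
      GenCoreExpr A Var (V ∪ W)
  | strEq {V : Finset Var} (p : GenCoreExpr A Var V) (x y : {x : Var // x ∈ V}) :
      GenCoreExpr A Var V
  | diff {V : Finset Var} (p q : GenCoreExpr A Var V) : GenCoreExpr A Var V

/-- The spanner that an expression represents. -/
def GenCoreExpr.spanner {A : Type u} {Var : Type v} [DecidableEq Var] {V : Finset Var} :
    GenCoreExpr A Var V → Spanner A V
  | .rgx γ _ => γ.spanner
  | .union p q => p.spanner.union q.spanner
  | .proj p h => p.spanner.proj h
  | .join p q => p.spanner.join q.spanner
  | .strEq p x y => p.spanner.strEq x y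
  | .diff p q => p.spanner.diff q.spanner

/-- A generalized core spanner is a spanner that is represented by such an expression. -/
def Spanner.IsGeneralizedCore {A : Type u} {Var : Type v} [DecidableEq Var] {V : Finset Var}
    (P : Spanner A V) : Prop :=
  ∃ p : GenCoreExpr A Var V, p.spanner = P

/-- For a language `L ⊆ {a}*`, the set of all numbers `m` such that `a^m ∈ L`. -/
def lengthSet {A : Type u} (a : A) (L : Language A) : Set ℕ :=
  {m | List.replicate m a ∈ L}

end DocSpanner

/-!
On a word `a ⋯ a`, a span is determined by its two ends and its content by their difference. A
record is thus a tuple of natural numbers, and every operation on spanners becomes an operation on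
Presburger definable relations: union, difference and join are Boolean combinations
(`Spanner.holds_union`, `Spanner.holds_diff`, `Spanner.holds_join`), projection is existential
quantification (`Spanner.holds_proj`), and string-equality selection is the linear equation that
says that two spans have the same length (`Spanner.holds_strEq`).

It remains to define the matches of regex formulas (`VarRegex.isPresburger_match`). The relation
`VarRegex.Match a γ T k l f` says that some parse of `a ⋯ a` from position `k` to position `l`
assigns the span `f x` to every `x ∈ T`. A match of a concatenation splits `T` into the variables
assigned on the left and the rest. For an iteration, only at most `|T|` rounds are relevant to `T`,
so it unfolds along subsets of `T` (`VarRegex.match_star_nonempty`). The blocks of rounds in between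
assign nothing that matters; the lengths of the words they match form a submonoid of `ℕ`, which is
finitely generated and hence semilinear (`IsPresburger.mem_addSubmonoid`).

Conversely, a Presburger definable set of natural numbers is ultimately periodic, and the unary
language of an ultimately periodic set of lengths is described by a regular expression without
captures (`exists_isGeneralizedCore_of_definable_lengthSet`).
-/

namespace DocSpanner

/-! ### Presburger predicates -/

section Presburger

open FirstOrder Language

/-- A predicate on valuations `α → ℕ` that is definable without parameters in Presburger
arithmetic. The set `α` of available variables may be infinite. -/
def IsPresburger {α : Type*} (p : (α → ℕ) → Prop) : Prop :=
  Set.Definable (∅ : Set ℕ) FirstOrder.Language.presburger {v : α → ℕ | p v}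

namespace IsPresburger

variable {α β : Type*} {p q : (α → ℕ) → Prop}

theorem congr (h : IsPresburger p) (hpq : ∀ v, q v ↔ p v) : IsPresburger q := by
  rwa [show q = p from funext fun v => propext (hpq v)]

theorem realize_eq (t s : presburger.Term α) :
    IsPresburger fun v : α → ℕ => t.realize v = s.realize v :=
  Set.empty_definable_iff.2 ⟨t.equal s, by ext v; simp [Formula.realize_equal]⟩

theorem eq (i j : α) : IsPresburger fun v : α → ℕ => v i = v j :=
  realize_eq (Term.var i) (Term.var j)

theorem eq_one (i : α) : IsPresburger fun v : α → ℕ => v i = 1 :=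
  realize_eq (Term.var i) 1

theorem eq_add (i j k : α) : IsPresburger fun v : α → ℕ => v i = v j + v k :=
  (realize_eq (Term.var i) (Term.var j + Term.var k)).congr fun v => by simp

theorem add_eq_add (i j k l : α) : IsPresburger fun v : α → ℕ => v i + v j = v k + v l :=
  realize_eq (Term.var i + Term.var j) (Term.var k + Term.var l)

theorem false : IsPresburger fun _ : α → ℕ => False :=
  Set.definable_empty

theorem and (hp : IsPresburger p) (hq : IsPresburger q) : IsPresburger fun v => p v ∧ q v :=
  Set.Definable.inter hp hq

theorem or (hp : IsPresburger p) (hq : IsPresburger q) : IsPresburger fun v => p v ∨ q v :=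
  Set.Definable.union hp hq

theorem not (hp : IsPresburger p) : IsPresburger fun v => ¬ p v :=
  Set.Definable.compl hp

theorem comp (hp : IsPresburger p) (f : α → β) : IsPresburger fun v : β → ℕ => p (v ∘ f) :=
  Set.Definable.preimage_comp f hp

theorem exists_mem {ι : Type*} {r : ι → (α → ℕ) → Prop} (s : Finset ι)
    (h : ∀ i ∈ s, IsPresburger (r i)) : IsPresburger fun v => ∃ i ∈ s, r i v := by
  have := Set.definable_iUnion_of_finite (f := fun i : s => {v | r i v}) fun i => h i i.2
  rw [IsPresburger]
  convert! this using 1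
  ext v
  simp

theorem exists_valuation [Finite β] {r : (α → ℕ) → (β → ℕ) → Prop}
    (h : IsPresburger fun w : α ⊕ β → ℕ => r (w ∘ Sum.inl) (w ∘ Sum.inr)) :
    IsPresburger fun v => ∃ u, r v u :=
  Set.Definable.exists_of_finite (S := {w : α ⊕ β → ℕ | r (w ∘ Sum.inl) (w ∘ Sum.inr)}) h

theorem exists_nat {r : ℕ → (α → ℕ) → Prop}
    (h : IsPresburger fun w : Option α → ℕ => r (w none) (w ∘ some)) :
    IsPresburger fun v => ∃ n, r n v := by
  have h' := exists_valuation (α := α) (β := Unit) (r := fun v u => r (u ()) v)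
    (h.comp (β := α ⊕ Unit) fun o => o.elim (Sum.inr ()) Sum.inl)
  exact h'.congr fun v => ⟨fun ⟨n, hn⟩ => ⟨fun _ => n, hn⟩, fun ⟨u, hu⟩ => ⟨u (), hu⟩⟩

/-- Additive submonoids of `ℕ` are finitely generated, so they are Presburger definable. -/
theorem mem_addSubmonoid (M : AddSubmonoid ℕ) (i : α) :
    IsPresburger fun v : α → ℕ => v i ∈ M := by
  have h : Set.Definable₁ (∅ : Set ℕ) presburger (M : Set ℕ) := by
    rw [presburger.definable₁_iff_ultimately_periodic, ← Nat.isSemilinearSet_iff_ultimately_periodic]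
    exact IsSemilinearSet.of_fg (Nat.addSubmonoid_fg M)
  exact comp (p := fun x : Fin 1 → ℕ => x 0 ∈ M) h fun _ => i

end IsPresburger

end Presburger

/-! ### Parses -/

namespace VarRegex

section Parse

variable {A : Type u} {Var : Type v} {γ δ : VarRegex A Var} {k : ℕ} {w : List A}
  {c : List (Var × (ℕ × ℕ))}

namespace Parse

theorem empty_iff : ¬ Parse (empty : VarRegex A Var) k w c := nofun

theorem epsilon_iff : Parse (VarRegex.epsilon : VarRegex A Var) k w c ↔ w = [] ∧ c = [] :=
  ⟨fun h => by cases h; exact ⟨rfl, rfl⟩, fun ⟨h, h'⟩ => by subst h h'; exact .epsilon k⟩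

theorem letter_iff {σ : A} :
    Parse (VarRegex.letter σ : VarRegex A Var) k w c ↔ w = [σ] ∧ c = [] :=
  ⟨fun h => by cases h; exact ⟨rfl, rfl⟩, fun ⟨h, h'⟩ => by subst h h'; exact .letter σ k⟩

theorem alt_iff : Parse (alt γ δ) k w c ↔ Parse γ k w c ∨ Parse δ k w c :=
  ⟨fun h => by cases h with | alt_left h => exact .inl h | alt_right h => exact .inr h,
    fun h => h.elim .alt_left .alt_right⟩

theorem concat_iff : Parse (VarRegex.concat γ δ) k w c ↔
    ∃ w₁ w₂ c₁ c₂, w = w₁ ++ w₂ ∧ c = c₁ ++ c₂ ∧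
      Parse γ k w₁ c₁ ∧ Parse δ (k + w₁.length) w₂ c₂ :=
  ⟨fun h => by cases h with | concat h₁ h₂ => exact ⟨_, _, _, _, rfl, rfl, h₁, h₂⟩,
    fun ⟨_, _, _, _, h, h', h₁, h₂⟩ => by subst h h'; exact .concat h₁ h₂⟩

theorem capture_iff {x : Var} : Parse (VarRegex.capture x γ) k w c ↔
    ∃ c', c = (x, (k, k + w.length)) :: c' ∧ Parse γ k w c' :=
  ⟨fun h => by cases h with | capture h => exact ⟨_, rfl, h⟩,
    fun ⟨_, h, h'⟩ => by subst h; exact .capture h'⟩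

/-- Induction along the iterations of a parse of `star γ`. -/
theorem star_induction 
    {motive : ∀ (k : ℕ) (w : List A) (c : List (Var × (ℕ × ℕ))), Parse (star γ) k w c → Prop}
    (nil : ∀ k, motive k [] [] (.star_nil k))
    (cons : ∀ k w₁ w₂ c₁ c₂ (h₁ : Parse γ k w₁ c₁) (h₂ : Parse (star γ) (k + w₁.length) w₂ c₂),
      motive (k + w₁.length) w₂ c₂ h₂ → motive k (w₁ ++ w₂) (c₁ ++ c₂) (.star_cons h₁ h₂))
    (h : Parse (star γ) k w c) : motive k w c h := by
  suffices ∀ δ (h : Parse δ k w c) (hδ : δ = star γ), motive k w c (hδ ▸ h) from this _ h rfl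
  intro δ h hδ
  induction h with
  | star_nil k => cases hδ; exact nil k
  | star_cons h₁ h₂ _ ih => cases hδ; exact cons _ _ _ _ _ h₁ h₂ (ih h₂ rfl)
  | _ => cases hδ

theorem star_append {w' : List A} {c' : List (Var × (ℕ × ℕ))} (h : Parse (star γ) k w c)
    (h' : Parse (star γ) (k + w.length) w' c') : Parse (star γ) k (w ++ w') (c ++ c') := by
  induction h using star_induction with
  | nil k => simpa using h'
  | cons k w₁ w₂ c₁ c₂ h₁ h₂ ih =>
    rw [List.append_assoc, List.append_assoc]
    exact .star_cons h₁ (ih (by rwa [add_assoc, ← List.length_append]))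

theorem exists_shift (h : Parse γ k w c) (l : ℕ) : ∃ c', Parse γ l w c' := by
  induction h generalizing l with
  | epsilon => exact ⟨_, .epsilon l⟩
  | letter σ => exact ⟨_, .letter σ l⟩
  | alt_left _ ih => exact (ih l).imp fun _ => .alt_left
  | alt_right _ ih => exact (ih l).imp fun _ => .alt_right
  | concat _ _ ih₁ ih₂ =>
    obtain ⟨_, h₁⟩ := ih₁ l
    obtain ⟨_, h₂⟩ := ih₂ _
    exact ⟨_, .concat h₁ h₂⟩
  | star_nil => exact ⟨_, .star_nil l⟩
  | star_cons _ _ ih₁ ih₂ =>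
    obtain ⟨_, h₁⟩ := ih₁ l
    obtain ⟨_, h₂⟩ := ih₂ _
    exact ⟨_, .star_cons h₁ h₂⟩
  | capture _ ih => exact (ih l).elim fun _ h => ⟨_, .capture h⟩

theorem capture_bounds (h : Parse γ k w c) :
    ∀ y ∈ c, k ≤ y.2.1 ∧ y.2.1 ≤ y.2.2 ∧ y.2.2 ≤ k + w.length := by
  induction h with
  | epsilon | letter | star_nil => simp
  | alt_left _ ih | alt_right _ ih => exact ih
  | concat _ _ ih₁ ih₂ | star_cons _ _ ih₁ ih₂ =>
    intro y hy
    rw [List.length_append]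
    rcases List.mem_append.1 hy with hy | hy
    · have := ih₁ y hy; omega
    · have := ih₂ y hy; omega
  | capture _ ih =>
    intro y hy
    rcases List.mem_cons.1 hy with rfl | hy
    · simp
    · exact ih y hy

end Parse

end Parse

/-! ### Matches on unary words -/

section Match

variable {A : Type u} {Var : Type v} {a : A} {γ δ : VarRegex A Var} {T : Finset Var} {k l m : ℕ}
  {f : Var → ℕ × ℕ}

/-- `Match a γ T k l f`: some parse of a word `a ⋯ a` that extends from position `k` to position
`l` assigns the span `f x` to each variable `x ∈ T`. Other captures in the parse, also further ones
of the variables in `T`, are disregarded, so that this makes sense for every expression and not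
only for functional ones. -/
def Match (a : A) (γ : VarRegex A Var) (T : Finset Var) (k l : ℕ) (f : Var → ℕ × ℕ) : Prop :=
  ∃ w c, (∀ σ ∈ w, σ = a) ∧ l = k + w.length ∧ Parse γ k w c ∧ ∀ x ∈ T, (x, f x) ∈ c

theorem match_empty : ¬ Match a empty T k l f := fun ⟨_, _, _, _, h, _⟩ => Parse.empty_iff h

theorem match_epsilon : Match a epsilon T k l f ↔ T = ∅ ∧ l = k := by
  simp +contextual [Match, Parse.epsilon_iff, Finset.eq_empty_iff_forall_notMem, and_comm]

theorem match_letter {σ : A} : Match a (letter σ) T k l f ↔ σ = a ∧ T = ∅ ∧ l = k + 1 := by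
  simp +contextual only [Match, Parse.letter_iff, Finset.eq_empty_iff_forall_notMem]
  constructor
  · rintro ⟨_, _, h, hl, ⟨rfl, rfl⟩, hT⟩
    simp_all
  · rintro ⟨rfl, h, rfl⟩
    exact ⟨[σ], [], by simp, by simp, ⟨rfl, rfl⟩, fun x hx => absurd hx (h x)⟩

theorem match_alt : Match a (alt γ δ) T k l f ↔ Match a γ T k l f ∨ Match a δ T k l f := by
  simp only [Match, Parse.alt_iff, ← exists_or]
  exact exists₂_congr fun _ _ => by tauto

/-- The lengths of the unary words that `star γ` matches. -/
def starLengths (a : A) (γ : VarRegex A Var) : AddSubmonoid ℕ where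
  carrier := {n | ∃ w c, (∀ σ ∈ w, σ = a) ∧ w.length = n ∧ Parse (star γ) 0 w c}
  zero_mem' := ⟨[], [], by simp, rfl, .star_nil 0⟩
  add_mem' := by
    rintro _ _ ⟨w₁, c₁, hw₁, rfl, h₁⟩ ⟨w₂, c₂, hw₂, rfl, h₂⟩
    obtain ⟨c₂', h₂'⟩ := h₂.exists_shift (0 + w₁.length)
    refine ⟨w₁ ++ w₂, _, ?_, List.length_append, h₁.star_append h₂'⟩
    simpa [or_imp, forall_and] using ⟨hw₁, hw₂⟩

theorem match_star_empty :
    Match a (star γ) ∅ k l f ↔ ∃ n, l = k + n ∧ n ∈ starLengths a γ := by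
  constructor
  · rintro ⟨w, c, hw, rfl, h, -⟩
    obtain ⟨c', h'⟩ := h.exists_shift 0
    exact ⟨_, rfl, w, c', hw, rfl, h'⟩
  · rintro ⟨_, rfl, w, c, hw, rfl, h⟩
    obtain ⟨c', h'⟩ := h.exists_shift k
    exact ⟨w, c', hw, rfl, h', by simp⟩

variable [DecidableEq Var]

theorem match_concat : Match a (concat γ δ) T k l f ↔
    ∃ T₁ ∈ T.powerset, ∃ m, Match a γ T₁ k m f ∧ Match a δ (T \ T₁) m l f := by
  constructor
  · rintro ⟨_, _, hw, rfl, h, hT⟩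
    obtain ⟨w₁, w₂, c₁, c₂, rfl, rfl, h₁, h₂⟩ := Parse.concat_iff.1 h
    classical
    refine ⟨T.filter fun x => (x, f x) ∈ c₁, by simp, k + w₁.length,
      ⟨w₁, c₁, fun σ h => hw σ (by simp [h]), rfl, h₁, by simp⟩,
      ⟨w₂, c₂, fun σ h => hw σ (by simp [h]), by simp [add_assoc], h₂, fun x hx => ?_⟩⟩
    have := hT x
    simp_all
  · rintro ⟨T₁, -, _, ⟨w₁, c₁, hw₁, rfl, h₁, hT₁⟩, ⟨w₂, c₂, hw₂, rfl, h₂, hT₂⟩⟩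
    refine ⟨w₁ ++ w₂, c₁ ++ c₂, ?_, by simp [add_assoc], .concat h₁ h₂, fun x hx => ?_⟩
    · simpa [or_imp, forall_and] using ⟨hw₁, hw₂⟩
    · by_cases hx₁ : x ∈ T₁
      · simp [hT₁ x hx₁]
      · simp [hT₂ x (by simp [hx, hx₁])]

theorem match_capture {x : Var} : Match a (capture x γ) T k l f ↔
    Match a γ T k l f ∨ (Match a γ (T.erase x) k l f ∧ (f x).1 = k ∧ (f x).2 = l) := by
  constructor
  · rintro ⟨w, _, hw, rfl, hc, hT⟩
    obtain ⟨c, rfl, h⟩ := Parse.capture_iff.1 hc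
    by_cases hx : f x = (k, k + w.length)
    · refine .inr ⟨⟨w, c, hw, rfl, h, fun y hy => ?_⟩, by simp [hx], by simp [hx]⟩
      rcases List.mem_cons.1 (hT y (Finset.mem_of_mem_erase hy)) with hyx | hyc
      · exact absurd (congrArg Prod.fst hyx) (Finset.ne_of_mem_erase hy)
      · exact hyc
    · refine .inl ⟨w, c, hw, rfl, h, fun y hy => ?_⟩
      rcases List.mem_cons.1 (hT y hy) with hyx | hyc
      · obtain rfl := congrArg Prod.fst hyx
        exact absurd (congrArg Prod.snd hyx) hx
      · exact hyc
  · rintro (⟨w, c, hw, rfl, h, hT⟩ | ⟨⟨w, c, hw, rfl, h, hT⟩, h₁, h₂⟩)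
    · exact ⟨w, _, hw, rfl, .capture h, fun y hy => List.mem_cons_of_mem _ (hT y hy)⟩
    · refine ⟨w, _, hw, rfl, .capture h, fun y hy => ?_⟩
      by_cases hyx : y = x
      · subst hyx
        rw [List.mem_cons]
        exact .inl (Prod.ext rfl (Prod.ext h₁ h₂))
      · exact List.mem_cons_of_mem _ (hT y (by simp [hy, hyx]))

/-- A match of `star γ` that assigns spans to the variables of a nonempty set `T` splits into some
iterations that are not needed for `T`, one that assigns the spans of a nonempty part of `T`, and
iterations that assign the spans of the rest of `T`. -/
theorem match_star_nonempty (hT : T.Nonempty) : Match a (star γ) T k l f ↔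
    ∃ T₁ ∈ T.powerset.filter Finset.Nonempty, ∃ m₁ m₂, Match a (star γ) ∅ k m₁ f ∧
      Match a γ T₁ m₁ m₂ f ∧ Match a (star γ) (T \ T₁) m₂ l f := by
  constructor
  · rintro ⟨w, c, hw, rfl, h, hc⟩
    induction h using Parse.star_induction with
    | nil => exact absurd (hc _ hT.choose_spec) (by simp)
    | cons k w₁ w₂ c₁ c₂ h₁ h₂ ih =>
      have hw₁ : ∀ σ ∈ w₁, σ = a := fun σ h => hw σ (by simp [h])
      have hw₂ : ∀ σ ∈ w₂, σ = a := fun σ h => hw σ (by simp [h])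
      classical
      by_cases hne : (T.filter fun x => (x, f x) ∈ c₁).Nonempty
      · refine ⟨T.filter fun x => (x, f x) ∈ c₁, by simp [hne], k, k + w₁.length,
          ⟨[], [], by simp, by simp, .star_nil k, by simp⟩, ⟨w₁, c₁, hw₁, rfl, h₁, by simp⟩,
          ⟨w₂, c₂, hw₂, by simp [add_assoc], h₂, fun x hx => ?_⟩⟩
        have := hc x
        simp_all
      · rw [Finset.not_nonempty_iff_eq_empty, Finset.filter_eq_empty_iff] at hne
        obtain ⟨T₁, hT₁, m₁, m₂, ⟨w, c, hw, rfl, h, -⟩, h', h''⟩ := ih hw₂ fun x hx =>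
          (List.mem_append.1 (hc x hx)).resolve_left (hne hx)
        refine ⟨T₁, hT₁, _, m₂, ⟨w₁ ++ w, c₁ ++ c, ?_, rfl, .star_cons h₁ h, by simp⟩, ?_, ?_⟩
        · simpa [or_imp, forall_and] using ⟨hw₁, hw⟩
        · rwa [List.length_append, ← add_assoc]
        · rwa [List.length_append, ← add_assoc]
  · rintro ⟨T₁, -, _, _, ⟨w₁, c₁, hw₁, rfl, h₁, -⟩, ⟨w₂, c₂, hw₂, rfl, h₂, hT₂⟩,
      ⟨w₃, c₃, hw₃, rfl, h₃, hT₃⟩⟩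
    refine ⟨w₁ ++ (w₂ ++ w₃), c₁ ++ (c₂ ++ c₃), ?_, by simp [add_assoc],
      h₁.star_append (.star_cons h₂ h₃), fun x hx => ?_⟩
    · simpa [or_imp, forall_and] using ⟨hw₁, hw₂, hw₃⟩
    · by_cases hx₁ : x ∈ T₁
      · simp [hT₂ x hx₁]
      · simp [hT₃ x (by simp [hx, hx₁])]

/-- The matches of a regular expression with captures on unary words are Presburger definable in
terms of the positions involved. The variables `i`, `j` stand for the ends of the match, `b x` and
`e x` for the ends of the span of `x`. -/
theorem isPresburger_match (a : A) (γ : VarRegex A Var) (T : Finset Var) {α : Type*} (i j : α)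
    (b e : Var → α) :
    IsPresburger fun v : α → ℕ => Match a γ T (v i) (v j) fun x => (v (b x), v (e x)) := by
  induction γ generalizing T α with
  | empty => exact IsPresburger.false.congr fun v => iff_false_intro match_empty
  | epsilon =>
    by_cases hT : T = ∅
    · exact (IsPresburger.eq j i).congr fun v => by simp [match_epsilon, hT]
    · exact IsPresburger.false.congr fun v => by simp [match_epsilon, hT]
  | letter σ =>
    by_cases hT : σ = a ∧ T = ∅
    · refine (IsPresburger.realize_eq (.var j) (.var i + 1)).congr fun v => ?_
      simp [match_letter, hT]
    · exact IsPresburger.false.congr fun v => by simp [match_letter]; tauto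
  | alt γ δ ihγ ihδ =>
    exact ((ihγ T i j b e).or (ihδ T i j b e)).congr fun v => match_alt
  | concat γ δ ihγ ihδ =>
    refine IsPresburger.congr ?_ fun v => match_concat
    refine IsPresburger.exists_mem _ fun T₁ _ => IsPresburger.exists_nat ?_
    exact (ihγ T₁ (some i) none (some ∘ b) (some ∘ e)).and
      (ihδ (T \ T₁) none (some j) (some ∘ b) (some ∘ e))
  | capture x γ ih =>
    refine IsPresburger.congr ?_ fun v => match_capture
    exact (ih T i j b e).or
      ((ih (T.erase x) i j b e).and ((IsPresburger.eq (b x) i).and (IsPresburger.eq (e x) j)))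
  | star γ ih =>
    have ih_empty {α : Type _} (i j : α) (b e : Var → α) : IsPresburger fun v : α → ℕ =>
        Match a (star γ) ∅ (v i) (v j) fun x => (v (b x), v (e x)) := by
      refine IsPresburger.congr ?_ fun v => match_star_empty
      exact IsPresburger.exists_nat ((IsPresburger.eq_add (some j) (some i) none).and
        (IsPresburger.mem_addSubmonoid (starLengths a γ) none))
    induction T using Finset.strongInduction generalizing α with
    | H T ihT =>
      rcases T.eq_empty_or_nonempty with rfl | hT
      · exact ih_empty i j b e
      refine IsPresburger.congr ?_ fun v => match_star_nonempty hT
      refine IsPresburger.exists_mem _ fun T₁ hT₁ =>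
        IsPresburger.exists_nat (IsPresburger.exists_nat ?_)
      simp only [Finset.mem_filter, Finset.mem_powerset] at hT₁
      let b' : Var → Option (Option α) := fun x => some (some (b x))
      let e' : Var → Option (Option α) := fun x => some (some (e x))
      exact (ih_empty (some (some i)) (some none) b' e').and
        ((ih T₁ (some none) none b' e').and
          (ihT (T \ T₁) (Finset.sdiff_ssubset hT₁.1 hT₁.2) none (some (some j)) b' e'))

end Match

end VarRegex

/-! ### Generalized core spanners on unary words -/

section Core

variable {A : Type u} {Var : Type v} {a : A} {n : ℕ} {f g : Var → ℕ × ℕ}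

namespace Spanner

variable {V W Y : Finset Var} {P Q : Spanner A V}

/-- `Holds a P n f`: on the word `a ⋯ a` of length `n`, the spanner `P` has the record that assigns
the span `f x` to each of its variables `x`. -/
def Holds (a : A) (P : Spanner A V) (n : ℕ) (f : Var → ℕ × ℕ) : Prop :=
  ∃ r ∈ P (List.replicate n a), ∀ x, (r x).1 = f x.1

theorem holds_union : Holds a (P.union Q) n f ↔ Holds a P n f ∨ Holds a Q n f := by
  simp only [Holds, union, Set.mem_union, or_and_right, exists_or]

/-- At most one record has given spans, so that `Holds` commutes with set difference. -/
theorem holds_diff : Holds a (P.diff Q) n f ↔ Holds a P n f ∧ ¬ Holds a Q n f := by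
  constructor
  · rintro ⟨r, ⟨hP, hQ⟩, hr⟩
    refine ⟨⟨r, hP, hr⟩, ?_⟩
    rintro ⟨r', hQ', hr'⟩
    obtain rfl : r' = r := funext fun x => Subtype.ext ((hr' x).trans (hr x).symm)
    exact hQ hQ'
  · rintro ⟨⟨r, hP, hr⟩, h⟩
    exact ⟨r, ⟨hP, fun hQ => h ⟨r, hQ, hr⟩⟩, hr⟩

theorem holds_congr (h : ∀ x ∈ V, f x = g x) : Holds a P n f ↔ Holds a P n g := by
  refine exists_congr fun r => and_congr_right fun _ => forall_congr' fun x => ?_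
  rw [h x x.2]

/-- The spans outside `Y` are existentially quantified in a projection to `Y`; `u` lists the
candidates for their two ends. -/
theorem holds_proj [DecidableEq Var] (h : Y ⊆ V) : Holds a (P.proj h) n f ↔
    ∃ u : {x // x ∈ V} × Bool → ℕ, Holds a P n fun x =>
      if hx : x ∈ V ∧ x ∉ Y then (u (⟨x, hx.1⟩, Bool.false), u (⟨x, hx.1⟩, true)) else f x := by
  constructor
  · rintro ⟨_, ⟨r, hP, rfl⟩, hr⟩
    refine ⟨fun y => if y.2 then (r y.1).1.2 else (r y.1).1.1, r, hP, fun x => ?_⟩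
    by_cases hx : x.1 ∈ Y
    · simpa [hx, Record.restrict] using hr ⟨x, hx⟩
    · simp [hx]
  · rintro ⟨u, r, hP, hr⟩
    refine ⟨_, ⟨r, hP, rfl⟩, fun x => ?_⟩
    simpa [Record.restrict] using hr ⟨x, h x.2⟩

theorem holds_join [DecidableEq Var] {P : Spanner A V} {Q : Spanner A W} :
    Holds a (P.join Q) n f ↔ Holds a P n f ∧ Holds a Q n f := by
  constructor
  · rintro ⟨r, ⟨hP, hQ⟩, hr⟩
    exact ⟨⟨_, hP, fun x => hr ⟨x, _⟩⟩, ⟨_, hQ, fun x => hr ⟨x, _⟩⟩⟩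
  · rintro ⟨⟨r, hP, hr⟩, ⟨r', hQ, hr'⟩⟩
    let r₀ : Record (V ∪ W) (List.replicate n a) := fun x =>
      if hx : x.1 ∈ V then r ⟨x, hx⟩ else r' ⟨x, (Finset.mem_union.1 x.2).resolve_left hx⟩
    have hr₀ : ∀ x, (r₀ x).1 = f x.1 := fun x => by
      by_cases hx : x.1 ∈ V
      · simpa [r₀, hx] using hr ⟨x, hx⟩
      · simpa [r₀, hx] using hr' ⟨x, (Finset.mem_union.1 x.2).resolve_left hx⟩
    refine ⟨r₀, ⟨?_, ?_⟩, hr₀⟩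
    · convert hP using 1
      exact funext fun x => Subtype.ext ((hr₀ ⟨x, _⟩).trans (hr x).symm)
    · convert hQ using 1
      exact funext fun x => Subtype.ext ((hr₀ ⟨x, _⟩).trans (hr' x).symm)

end Spanner

theorem Span.substring_replicate (p : Span (List.replicate n a)) :
    p.substring = List.replicate (p.1.2 - p.1.1) a := by
  have := p.2
  have hlen := List.length_replicate (n := n) (a := a)
  rw [Span.substring, List.drop_replicate, List.take_replicate]
  congr 1
  omega

namespace Spanner

variable {V W Y : Finset Var} {P Q : Spanner A V}

/-- Substrings of a unary word are equal if and only if they have the same length. -/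
theorem holds_strEq (x y : {x // x ∈ V}) : Holds a (P.strEq x y) n f ↔
    Holds a P n f ∧ (f x).2 + (f y).1 = (f y).2 + (f x).1 := by
  have key {r : Record V (List.replicate n a)} (hr : ∀ x, (r x).1 = f x.1) :
      (r x).substring = (r y).substring ↔ (f x).2 + (f y).1 = (f y).2 + (f x).1 := by
    have hx := (r x).2
    have hy := (r y).2
    rw [Span.substring_replicate, Span.substring_replicate, List.replicate_left_inj, ← hr x, ← hr y]
    omega
  constructor
  · rintro ⟨r, ⟨hP, he⟩, hr⟩
    exact ⟨⟨r, hP, hr⟩, (key hr).1 he⟩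
  · rintro ⟨⟨r, hP, hr⟩, he⟩
    exact ⟨r, ⟨hP, (key hr).2 he⟩, hr⟩

theorem mem_recognized {P : Spanner A (∅ : Finset Var)} {s : List A} :
    s ∈ P.recognized ↔ (P s).Nonempty := by
  have : ∀ r : Record (∅ : Finset Var) s, r = Record.empty s := fun r =>
    funext fun x => absurd x.2 (Finset.notMem_empty x.1)
  refine ⟨fun h => ⟨_, h.ge rfl⟩, fun h => ?_⟩
  exact Set.eq_singleton_iff_nonempty_unique_mem.2 ⟨h, fun r _ => this r⟩

theorem mem_lengthSet_recognized {P : Spanner A (∅ : Finset Var)} :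
    n ∈ lengthSet a P.recognized ↔ Holds a P n f := by
  refine mem_recognized.trans (exists_congr fun r => (and_iff_left ?_).symm)
  exact fun x => absurd x.2 (Finset.notMem_empty x.1)

end Spanner

variable [DecidableEq Var]

theorem VarRegex.holds_spanner {γ : VarRegex A Var} :
    Spanner.Holds a γ.spanner n f ↔ γ.Match a γ.vars 1 (1 + n) f := by
  constructor
  · rintro ⟨r, ⟨c, h, hc⟩, hr⟩
    exact ⟨_, c, fun σ => List.eq_of_mem_replicate, by simp, h, fun x hx => hr ⟨x, hx⟩ ▸ hc ⟨x, hx⟩⟩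
  · rintro ⟨w, c, hw, hl, h, hc⟩
    obtain rfl : w = List.replicate n a := List.eq_replicate_iff.2 ⟨by omega, hw⟩
    refine ⟨fun x => ⟨f x, ?_⟩, ⟨c, h, fun x => hc x x.2⟩, fun x => rfl⟩
    have := h.capture_bounds _ (hc x x.2)
    exact ⟨this.1, this.2.1, this.2.2.trans_eq (add_comm _ _)⟩

/-- The records of a generalized core spanner on unary words are Presburger definable in terms of
the length of the word and the ends of the spans. The variable `i` stands for the length, `b x` and
`e x` stand for the ends of the span of `x`. -/
theorem GenCoreExpr.isPresburger_holds (a : A) {V : Finset Var} (p : GenCoreExpr A Var V)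
    {α : Type v} (i : α) (b e : Var → α) :
    IsPresburger fun v : α → ℕ => p.spanner.Holds a (v i) fun x => (v (b x), v (e x)) := by
  induction p generalizing α with
  | rgx γ hγ =>
    refine IsPresburger.congr (p := fun v => ∃ l k, k = 1 ∧ l = k + v i ∧
      γ.Match a γ.vars k l fun x => (v (b x), v (e x))) ?_ fun v => ?_
    · exact IsPresburger.exists_nat (IsPresburger.exists_nat ((IsPresburger.eq_one none).and
        ((IsPresburger.eq_add (some none) none (some (some i))).and
          (γ.isPresburger_match a γ.vars none (some none) (fun x => some (some (b x)))
            fun x => some (some (e x))))))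
    · simpa using! VarRegex.holds_spanner
  | union p q ihp ihq => exact ((ihp i b e).or (ihq i b e)).congr fun v => Spanner.holds_union
  | diff p q ihp ihq => exact ((ihp i b e).and (ihq i b e).not).congr fun v => Spanner.holds_diff
  | join p q ihp ihq => exact ((ihp i b e).and (ihq i b e)).congr fun v => Spanner.holds_join
  | strEq p x y ih =>
    exact ((ih i b e).and (IsPresburger.add_eq_add (e x) (b y) (e y) (b x))).congr fun v =>
      Spanner.holds_strEq x y
  | @proj V Y p h ih =>
    refine IsPresburger.congr ?_ fun v => Spanner.holds_proj h
    refine IsPresburger.exists_valuation ?_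
    let pos (c : Bool) (b : Var → α) (x : Var) : α ⊕ {x // x ∈ V} × Bool :=
      if hx : x ∈ V ∧ x ∉ Y then .inr (⟨x, hx.1⟩, c) else .inl (b x)
    refine (ih (.inl i) (pos Bool.false b) (pos true e)).congr fun w => ?_
    refine Spanner.holds_congr fun x _ => ?_
    by_cases hx : x ∈ V ∧ x ∉ Y <;> simp [pos, hx]

theorem Spanner.IsGeneralizedCore.definable_lengthSet {P : Spanner A (∅ : Finset Var)}
    (hP : P.IsGeneralizedCore) (a : A) :
    Set.Definable₁ (∅ : Set ℕ) FirstOrder.Language.presburger (lengthSet a P.recognized) := by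
  obtain ⟨p, rfl⟩ := hP
  have h := (p.isPresburger_holds a PUnit.unit (fun _ => PUnit.unit) fun _ => PUnit.unit).comp
    fun _ => (0 : Fin 1)
  exact h.congr fun v => Spanner.mem_lengthSet_recognized

end Core

/-! ### Ultimately periodic sets of lengths -/

namespace VarRegex

variable {A : Type u} {Var : Type v} {a : A} {k n : ℕ} {w : List A}

/-- The expression `a ⋯ a` with `n` letters. -/
def unary (a : A) : ℕ → VarRegex A Var
  | 0 => epsilon
  | n + 1 => concat (letter a) (unary a n)

/-- The alternation of the expressions `a ⋯ a` with `n` letters, for `n` in a list. -/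
def unaryAlt (a : A) : List ℕ → VarRegex A Var
  | [] => empty
  | n :: t => alt (unary a n) (unaryAlt a t)

theorem exists_parse_unary :
    (∃ c, Parse (unary a n : VarRegex A Var) k w c) ↔ w = List.replicate n a := by
  induction n generalizing k w with
  | zero => simp [unary, Parse.epsilon_iff]
  | succ n ih =>
    rw [unary]
    constructor
    · rintro ⟨c, h⟩
      obtain ⟨_, w₂, _, c₂, rfl, rfl, h₁, h₂⟩ := Parse.concat_iff.1 h
      obtain ⟨rfl, rfl⟩ := Parse.letter_iff.1 h₁
      rw [ih.1 ⟨c₂, h₂⟩]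
      rfl
    · rintro rfl
      obtain ⟨c, h⟩ := ih.2 rfl
      exact ⟨_, .concat (.letter a k) h⟩

theorem exists_parse_unaryAlt {t : List ℕ} :
    (∃ c, Parse (unaryAlt a t : VarRegex A Var) k w c) ↔ ∃ n ∈ t, w = List.replicate n a := by
  induction t with
  | nil => simp [unaryAlt, Parse.empty_iff]
  | cons n t ih => simp [unaryAlt, Parse.alt_iff, exists_or, exists_parse_unary, ih]

theorem exists_parse_star_unary :
    (∃ c, Parse (star (unary a n) : VarRegex A Var) k w c) ↔
      ∃ j, w = List.replicate (j * n) a := by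
  constructor
  · rintro ⟨c, h⟩
    induction h using Parse.star_induction with
    | nil k => exact ⟨0, by simp⟩
    | cons k w₁ w₂ c₁ c₂ h₁ h₂ ih =>
      obtain ⟨j, rfl⟩ := ih
      refine ⟨j + 1, ?_⟩
      rw [exists_parse_unary.1 ⟨c₁, h₁⟩, List.replicate_append_replicate]
      congr 1
      ring
  · rintro ⟨j, rfl⟩
    induction j generalizing k with
    | zero => exact ⟨[], by simpa using Parse.star_nil k⟩
    | succ j ih =>
      obtain ⟨c₁, h₁⟩ := exists_parse_unary (Var := Var) (k := k).2 (Eq.refl (List.replicate n a))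
      obtain ⟨c₂, h₂⟩ := ih (k := k + (List.replicate n a).length)
      refine ⟨c₁ ++ c₂, ?_⟩
      rw [add_mul, one_mul, add_comm, ← List.replicate_append_replicate]
      exact .star_cons h₁ h₂

variable [DecidableEq Var]

theorem vars_unary : (unary a n : VarRegex A Var).vars = ∅ := by
  induction n with simp_all [unary, vars]

theorem vars_unaryAlt {t : List ℕ} : (unaryAlt a t : VarRegex A Var).vars = ∅ := by
  induction t with simp_all [unaryAlt, vars, vars_unary]

/-- The language of a regular expression without captures is recognized by a Boolean generalized
core spanner. The projection to `∅` only serves to change the index `γ.vars` of the spanner, which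
need not be definitionally `∅`. -/
theorem exists_isGeneralizedCore {γ : VarRegex A Var} (hγ : γ.vars = ∅) :
    ∃ P : Spanner A (∅ : Finset Var), P.IsGeneralizedCore ∧
      ∀ s, s ∈ P.recognized ↔ ∃ c, Parse γ 1 s c := by
  have hno (x : Var) : x ∉ γ.vars := by simp [hγ]
  refine ⟨_, ⟨.proj (.rgx γ fun _ _ _ x hx => absurd hx (hno x)) (Finset.empty_subset _), rfl⟩,
    fun s => Spanner.mem_recognized.trans ⟨?_, ?_⟩⟩
  · rintro ⟨_, _, ⟨c, h, -⟩, -⟩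
    exact ⟨c, h⟩
  · rintro ⟨c, h⟩
    exact ⟨_, fun x => absurd x.2 (hno x), ⟨c, h, fun x => absurd x.2 (hno x)⟩, rfl⟩

end VarRegex

/-- An ultimately periodic set consists of the elements below the threshold `k` and of the
arithmetic progressions with difference `p` that start at its elements in `[k, k + p)`. -/
theorem mem_iff_of_ultimately_periodic {S : Set ℕ} {k p : ℕ} (hp : 0 < p)
    (h : ∀ x ≥ k, x ∈ S ↔ x + p ∈ S) (n : ℕ) :
    n ∈ S ↔ (n < k ∧ n ∈ S) ∨ ∃ r, (k ≤ r ∧ r < k + p ∧ r ∈ S) ∧ ∃ j, n = r + j * p := by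
  have step (r : ℕ) (hr : k ≤ r) (j : ℕ) : r ∈ S ↔ r + j * p ∈ S := by
    induction j with
    | zero => simp
    | succ j ih => rw [ih, h _ (by omega), add_mul, one_mul, add_assoc]
  constructor
  · intro hn
    rcases lt_or_ge n k with hk | hk
    · exact .inl ⟨hk, hn⟩
    · have hdiv := Nat.mod_add_div' (n - k) p
      have hlt := Nat.mod_lt (n - k) hp
      have hnr : n = k + (n - k) % p + (n - k) / p * p := by omega
      exact .inr ⟨k + (n - k) % p, ⟨by omega, by omega, (step _ (by omega) _).2 (hnr ▸ hn)⟩, _, hnr⟩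
  · rintro (⟨-, hn⟩ | ⟨r, ⟨hk, -, hr⟩, j, rfl⟩)
    · exact hn
    · exact (step r hk j).1 hr

theorem exists_isGeneralizedCore_of_definable_lengthSet {A Var : Type*} [DecidableEq Var] {a : A}
    {L : Language A} (hL : ∀ w ∈ L, ∀ σ ∈ w, σ = a)
    (h : Set.Definable₁ (∅ : Set ℕ) FirstOrder.Language.presburger (lengthSet a L)) :
    ∃ P : Spanner A (∅ : Finset Var), P.IsGeneralizedCore ∧ P.recognized = L := by
  classical
  obtain ⟨k, p, hp, hper⟩ :=
    FirstOrder.Language.presburger.definable₁_iff_ultimately_periodic.1 h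
  let F := (List.range (k + p)).filter (· ∈ lengthSet a L)
  obtain ⟨P, hP, hrec⟩ := VarRegex.exists_isGeneralizedCore (A := A) (Var := Var)
    (γ := .alt (.unaryAlt a (F.filter (· < k)))
      (.concat (.unaryAlt a (F.filter (k ≤ ·))) (.star (.unary a p))))
    (by simp [VarRegex.vars, VarRegex.vars_unary, VarRegex.vars_unaryAlt])
  refine ⟨P, hP, Set.ext fun s => (hrec s).trans ?_⟩
  have hs : s ∈ L ↔ ∃ n ∈ lengthSet a L, s = List.replicate n a :=
    ⟨fun hs => have he := List.eq_replicate_iff.2 ⟨rfl, hL s hs⟩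
      ⟨s.length, by rwa [lengthSet, Set.mem_ofPred_eq, ← he], he⟩, fun ⟨_, hn, he⟩ => he ▸ hn⟩
  simp only [VarRegex.Parse.alt_iff, exists_or, VarRegex.exists_parse_unaryAlt]
  refine Iff.trans ?_ hs.symm
  constructor
  · rintro (⟨n, hn, rfl⟩ | ⟨c, h⟩)
    · exact ⟨n, by simp_all [F], rfl⟩
    · obtain ⟨w₁, w₂, c₁, c₂, rfl, rfl, h₁, h₂⟩ := VarRegex.Parse.concat_iff.1 h
      obtain ⟨r, hr, rfl⟩ := VarRegex.exists_parse_unaryAlt.1 ⟨c₁, h₁⟩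
      obtain ⟨j, rfl⟩ := VarRegex.exists_parse_star_unary.1 ⟨c₂, h₂⟩
      refine ⟨r + j * p, (mem_iff_of_ultimately_periodic hp hper _).2 (.inr ⟨r, ?_, j, rfl⟩),
        List.replicate_append_replicate⟩
      simp only [F, List.mem_filter, List.mem_range, decide_eq_true_eq] at hr
      exact ⟨hr.2, hr.1⟩
  · rintro ⟨n, hn, rfl⟩
    rcases (mem_iff_of_ultimately_periodic hp hper n).1 hn with hn | ⟨r, hr, j, rfl⟩
    · refine .inl ⟨n, ?_, rfl⟩
      simp only [F, List.mem_filter, List.mem_range, decide_eq_true_eq]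
      exact ⟨⟨by omega, hn.2⟩, hn.1⟩
    · right
      obtain ⟨c₁, h₁⟩ := VarRegex.exists_parse_unaryAlt (Var := Var) (a := a) (k := 1)
        (t := F.filter (k ≤ ·)).2 ⟨r, by simp [F, hr], rfl⟩
      obtain ⟨c₂, h₂⟩ := VarRegex.exists_parse_star_unary (Var := Var) (a := a) (n := p)
        (k := 1 + (List.replicate r a).length).2 ⟨j, rfl⟩
      rw [← List.replicate_append_replicate]
      exact ⟨_, .concat h₁ h₂⟩

end DocSpanner

theorem mainTheorem3 {A : Type*} [Finite A] (a : A)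
    {Var : Type*} [Infinite Var] [DecidableEq Var]
    (L : Language A) (hL : ∀ w ∈ L, ∀ σ ∈ w, σ = a) :
    (∃ P : DocSpanner.Spanner A (∅ : Finset Var), P.IsGeneralizedCore ∧ P.recognized = L) ↔
      Set.Definable₁ (∅ : Set ℕ) FirstOrder.Language.presburger (DocSpanner.lengthSet a L) := by
  refine ⟨?_, DocSpanner.exists_isGeneralizedCore_of_definable_lengthSet hL⟩
  rintro ⟨P, hP, rfl⟩
  exact hP.definable_lengthSet a
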